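/- **Notation.** For $f:\mathbb N_{\ge 1}\to\mathbb N$ and $s\in\mathbb N$ let ${}^{s}f(n)=f(s+n)$. Define numbers $\mathcal B_m(f)$, $m\ge 1$, by recursion on $m$. Put $\mathcal B_1(f)=f(1)+1$. For $m\ge 2$ put $\mathcal B_m(f)=\mathcal B_m^{0}(f)$, where $\mathcal B_m^{m}(f,b_1,\dots,b_m)=(b_1+1)\cdots(b_m+1)$ and, for $0\le k<m$ and $\beta\in\mathbb N^k$, $\mathcal B_m^{k}(f,\beta)=g\big(\mathcal B_{m-1}(f\circ g)+1\big)$, the function $g$ being given by $g(1)=1$ and $g(n+1)=1+g(n)+\mathcal B_m^{k+1}\big({}^{g(n)}f,\beta,f(g(n))\big)$ for $n\ge 1$. For $m\geq 1$ and $d\ge 0$ let $\gamma_{m,d}(i)=\big(3^{\mathcal B_m(h)-1}-1\big)d+i$, where $h(n)=3^{n}d$ (so $\gamma_{m,0}(i)=i$). For $\delta\in\mathbb N^m$ let $|\delta|=\delta_1+\dots+\delta_m$. Let $F_1,\dots,F_s\in\mathbb Z[\underline a][x_1,\dots,x_m]$, where $\underline a=(a_1,\dots,a_n)$, have degree at most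 $d$ in $x_1,\dots,x_m$, with $F_i=\sum_{|\alpha|\le d}f_{i,\alpha}x^\alpha$ and $f_{i,\alpha}\in\mathbb Z[\underline a]$. Let $A=A^{d,d'}_{F_1,\dots,F_s}$ be the matrix with rows indexed by the $\delta\in\mathbb N^m$ with $|\delta|\le d+d'$, columns indexed by the pairs $(i,\beta)$ with $1\le i\le s$, $\beta\in\mathbb N^m$, $|\beta|\le d'$, and entries $A(\delta,(i,\beta))=f_{i,\delta-\beta}$ if $\beta\le\delta$ componentwise (with $f_{i,\alpha}=0$ for $|\alpha|>d$) and $0$ otherwise. It is the coefficient matrix of the linear system expressing $H_1F_1+\dots+H_sF_s=1$ in the coefficients of unknown polynomials $H_i$ of degree at most $d'$. Let $\widehat A=(A\mid B)$, where the column $B$ has entry $1$ in the row $\delta=0$ and $0$ in all other rows. Let $\Delta^{d,d'}_{F_1,\dots,F_s}(\underline a)$ be the formula $$\bigwedge_{M}\Big(\det M\ne 0\ \to\ \bigvee_{N}\det N\neq 0\Big),$$ where $M$ runs over the square submatrices of $A$ (of order at least $1$), and $N$ over the square submatrices of $\widehat A$ whose order is greater than that of $M$. **Theorem 3.2.** Let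 $n,s\ge 0$ and $m\ge 1$, let $F_1,\dots,F_s\in\mathbb Z[\underline a][x_1,\dots,x_m]$, and let $\varphi(\underline a)$ be the formula $\exists x_1\cdots\exists x_m\,(F_1(x)=0\wedge\dots\wedge F_s(x)=0)$. Let $d$ be the maximum of the degrees of $F_1,\dots,F_s$ with respect to $x_1,\dots,x_m$ (zero polynomials counting as degree $0$, and $d=0$ if $s=0$), and let $d'=\gamma_{m,d}(0)$. Then $$\mathrm{ACF}\vdash\varphi(\underline a)\leftrightarrow\Delta^{d,d'}_{F_1,\dots,F_s}(\underline a),$$ that is, the equivalence holds in every algebraically closed field (of any characteristic) for all values of $\underline a$. Moreover $\Delta^{d,d'}_{F_1,\dots,F_s}$ is quantifier-free, and for every field $K$ and every $\underline a\in K^n$ it holds at $\underline a$ if and only if $\operatorname{rk}\widehat A(\underline a)>\operatorname{rk}A(\underline a)$. -/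

import Mathlib

open FirstOrder FirstOrder.Language

namespace TarskiQE

/-! ### The bound

Sequences `ℕ₁ → ℕ₁` are represented by functions `ℕ → ℕ`; the value at `0` is never used. -/

/-- The sequence `g` with `g 1 = 1` and `g (n + 1) = 1 + g n + C (f shifted by g n) (f (g n))`
for `n ≥ 1`.  The value `g 0 = 0` is a dummy. -/
def gSeq (C : (ℕ → ℕ) → ℕ → ℕ) (f : ℕ → ℕ) : ℕ → ℕ
  | 0 => 0
  | 1 => 1
  | n + 2 => 1 + gSeq C f (n + 1) +
      C (fun i => f (gSeq C f (n + 1) + i)) (f (gSeq C f (n + 1)))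

/-- The auxiliary functions `𝓑_m^k : 𝔽 × ℕ^k → ℕ` for `m = k + j`, built by recursion on
`j = m - k` (that is, by backward induction on `k`), where `Bprev` stands for `𝓑_{m-1}`. -/
def boundAux (Bprev : (ℕ → ℕ) → ℕ) : (j k : ℕ) → (ℕ → ℕ) → (Fin k → ℕ) → ℕ
  | 0, _, _, β => ∏ i, (β i + 1)
  | j + 1, k, f, β =>
      let g := gSeq (fun f' b => boundAux Bprev j (k + 1) f' (Fin.snoc β b)) f
      g (Bprev (f ∘ g) + 1)

/-- The function `𝓑(m, f) = 𝓑_m(f)`, for `m ≥ 1`.  The value at `m = 0` is a dummy. -/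
def bound : ℕ → (ℕ → ℕ) → ℕ
  | 0, _ => 0
  | 1, f => f 1 + 1
  | m + 2, f => boundAux (bound (m + 1)) (m + 2) 0 f Fin.elim0

/-- `γ_{m,d}(i) = (3 ^ (𝓑(m, 3ⁿd) - 1) - 1) d + i`. -/
def gamma (m d i : ℕ) : ℕ :=
  (3 ^ (bound m (fun n => 3 ^ n * d) - 1) - 1) * d + i

/-! ### The coefficient matrix and the augmented matrix -/

/-- Exponent vectors `δ ∈ ℕ^m` with `|δ| ≤ N`. -/
abbrev Exponents (m N : ℕ) : Type := {δ : Fin m →₀ ℕ // δ.degree ≤ N}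

instance (m N : ℕ) : Finite (Exponents m N) :=
  (Finsupp.finite_of_degree_le N).to_subtype

noncomputable instance (m N : ℕ) : Fintype (Exponents m N) := Fintype.ofFinite _

section Matrices

variable {n m s : ℕ}

open Classical in
/-- The coefficient matrix `A` of the linear system expressing `H₁F₁ + ⋯ + H_sF_s = 1`, whose
unknowns are the coefficients `c_{i,β}`, `|β| ≤ d'`, of `H₁, …, H_s`; there is one equation for
each monomial `x^δ` with `|δ| ≤ d + d'`. -/
noncomputable def coeffMatrix (d d' : ℕ)
    (F : Fin s → MvPolynomial (Fin m) (MvPolynomial (Fin n) ℤ)) :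
    Matrix (Exponents m (d + d')) (Fin s × Exponents m d') (MvPolynomial (Fin n) ℤ) :=
  Matrix.of fun δ iβ =>
    if iβ.2.1 ≤ δ.1 then (F iβ.1).coeff (δ.1 - iβ.2.1) else 0

open Classical in
/-- The augmented matrix `(A | B)`; the right hand side `B` is `1` in the row of the constant
monomial and `0` in all other rows. -/
noncomputable def augMatrix (d d' : ℕ)
    (F : Fin s → MvPolynomial (Fin m) (MvPolynomial (Fin n) ℤ)) :
    Matrix (Exponents m (d + d')) ((Fin s × Exponents m d') ⊕ Unit) (MvPolynomial (Fin n) ℤ) :=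
  Matrix.fromCols (coeffMatrix d d' F) (Matrix.of fun δ _ => if δ.1 = 0 then 1 else 0)

end Matrices

/-- Square submatrices (of order at least `1`) of a matrix with rows `R` and columns `C`: the
order `k + 1` together with a choice of `k + 1` different rows and `k + 1` different columns.
(They may be listed in any order, which changes the determinant at most by a sign.) -/
abbrev SquareSub (R C : Type) [Fintype R] : Type :=
  Σ k : Fin (Fintype.card R), (Fin (k + 1) ↪ R) × (Fin (k + 1) ↪ C)

/-- The order of a square submatrix. -/
def SquareSub.order {R C : Type} [Fintype R] (M : SquareSub R C) : ℕ := M.1 + 1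

/-- The minor belonging to a square submatrix. -/
noncomputable def SquareSub.det {R C : Type} {S : Type*} [Fintype R] [CommRing S] (M : SquareSub R C)
    (A : Matrix R C S) : S :=
  (A.submatrix M.2.1 M.2.2).det

/-! ### Formulas in the language of rings -/

/-- The theory of algebraically closed fields (of arbitrary characteristic): the field axioms,
and for each `k ≥ 1` the axiom that every monic polynomial of degree `k` has a root. -/
noncomputable def ACF : Language.ring.Theory :=
  Theory.field ∪ FirstOrder.Field.genericMonicPolyHasRoot '' {k | 0 < k}

/-- A term of the language of rings that represents an integer polynomial. -/
noncomputable def polyTerm {σ : Type} (p : MvPolynomial σ ℤ) : Language.ring.Term σ :=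
  FirstOrder.Ring.termOfFreeCommRing ((freeCommRingEquivMvPolynomialInt σ).symm p)

section Formulas

variable {n m s : ℕ}

/-- A polynomial `G ∈ ℤ[a][x]` regarded as an integer polynomial in all variables `a, x`. -/
noncomputable def jointPoly (G : MvPolynomial (Fin m) (MvPolynomial (Fin n) ℤ)) :
    MvPolynomial (Fin n ⊕ Fin m) ℤ :=
  MvPolynomial.eval₂ (MvPolynomial.rename (R := ℤ) (Sum.inl : Fin n → Fin n ⊕ Fin m)).toRingHom
    (fun j => MvPolynomial.X (Sum.inr j)) G

/-- The common root formula `∃ x₁ ⋯ x_m, F₁(x) = 0 ∧ ⋯ ∧ F_s(x) = 0` with free variables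
`a₁, …, a_n`. -/
noncomputable def commonRootFormula
    (F : Fin s → MvPolynomial (Fin m) (MvPolynomial (Fin n) ℤ)) :
    Language.ring.Formula (Fin n) :=
  (BoundedFormula.iInf fun i : Fin s =>
    (Term.bdEqual (polyTerm (jointPoly (F i))) 0 :
      Language.ring.BoundedFormula (Fin n) m)).exs

/-- The quantifier-free formula `p(a) ≠ 0`. -/
noncomputable def neZero (p : MvPolynomial (Fin n) ℤ) : Language.ring.Formula (Fin n) :=
  (Term.equal (polyTerm p) 0).not

/-- The formula `Δ`: for every square submatrix `M` of `A` with `det M ≠ 0` there is a square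
submatrix `N` of the augmented matrix, of order greater than that of `M`, with `det N ≠ 0`. -/
noncomputable def delta (d d' : ℕ)
    (F : Fin s → MvPolynomial (Fin m) (MvPolynomial (Fin n) ℤ)) :
    Language.ring.Formula (Fin n) :=
  BoundedFormula.iInf fun M : SquareSub (Exponents m (d + d')) (Fin s × Exponents m d') =>
    (neZero (M.det (coeffMatrix d d' F))).imp
      (BoundedFormula.iSup
        fun N : {N : SquareSub (Exponents m (d + d')) ((Fin s × Exponents m d') ⊕ Unit) //
            M.order < N.order} =>
          neZero (N.1.det (augMatrix d d' F)))

end Formulas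

end TarskiQE

/-!
Let `K` be an algebraically closed field and `a ∈ K^n`.  The polynomials `Fᵢ(a, x)`, of degree at
most `d`, have no common zero if and only if `1 = ∑ Hᵢ Fᵢ` for some `Hᵢ`.
For `Hᵢ` of degree at most `d'` this identity is the linear system with augmented matrix `(A | B)`,
which is unsolvable if and only if `rk A < rk (A | B)` (`rank_lt_rank_fromCols_iff`); the formula
`Δ` says this in terms of minors (`rank_lt_rank_iff`).  What remains is an effective
Nullstellensatz: if the `Fᵢ` have no common zero, then `Hᵢ` of degree at most `γ_{m,d}(0)` exist.

It is proved by elimination (`one_mem_boundedCombinations`).  Let `S` be a set of polynomials of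
degree at most `d` in `m + 1` variables without common zero, and let `F ∈ S` be nonzero.  After a
linear change of coordinates `F` is monic, up to a constant, in one variable
(`exists_coordinate_change`).  The resultants of `F` with the elements `G` of the span of `S` are
polynomials in the other `m` variables of degree at most `4d²`.  They have no common zero, since
`F` has finitely many zeros over a given point, and some `G` vanishes at none of these
(`exists_eval_resultant_ne_zero`).  They are combinations of `F` and `G` with cofactors of
controlled degree, because the cofactors come from the adjugate of the Sylvester matrix
(`mul_resultant_mem_boundedCombinations`).  So induction on the number of variables gives `1` as
a combination whose terms have degree at most `T = (4d)^(2^m) / 4` (`four_mul_elimDegree`), and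
hence `deg Hᵢ ≤ T - d`.

The bound `γ_{m,d}(0)` is large enough: already the crude estimate `𝓑_m(3ⁿd) > 3^m d` (`lt_bound`)
gives `T ≤ 3 ^ (3 ^ m d) d ≤ γ_{m,d}(0) + d` (`elimDegree_le_gamma_add`).
-/

namespace TarskiQE

/-! ### Comparison of the bounds -/

lemma gSeq_one (C : (ℕ → ℕ) → ℕ → ℕ) (f : ℕ → ℕ) : gSeq C f 1 = 1 := by
  simp [gSeq]

lemma gSeq_succ_succ (C : (ℕ → ℕ) → ℕ → ℕ) (f : ℕ → ℕ) (n : ℕ) :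
    gSeq C f (n + 2) = 1 + gSeq C f (n + 1) +
      C (fun i => f (gSeq C f (n + 1) + i)) (f (gSeq C f (n + 1))) := by
  rw [gSeq]

lemma gSeq_monotone (C : (ℕ → ℕ) → ℕ → ℕ) (f : ℕ → ℕ) : Monotone (gSeq C f) :=
  monotone_nat_of_le_succ fun n => by
    rcases n with _ | n
    · simp [gSeq]
    · rw [gSeq_succ_succ]
      omega

/-- In each of the `j + 1` recursion steps it suffices to use `g` at the argument `2`: the sequence
`f` is shifted by `g 1 = 1`, which multiplies the lower bound `3ⁿD` by `3`, and the innermost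
product has the last value of `f` among its factors. -/
lemma lt_boundAux {Bprev : (ℕ → ℕ) → ℕ} (hB : ∀ f, 1 ≤ Bprev f) (j : ℕ) :
    ∀ (k D : ℕ) (f : ℕ → ℕ) (β : Fin k → ℕ), (∀ n, 3 ^ n * D ≤ f n) →
      3 ^ (j + 1) * D < boundAux Bprev (j + 1) k f β := by
  induction j with
  | zero =>
    intro k D f β hf
    rw [boundAux]
    refine lt_of_lt_of_le ?_ (gSeq_monotone _ f (Nat.succ_le_succ (hB _)))
    rw [gSeq_succ_succ, zero_add, gSeq_one, boundAux, Fin.prod_univ_castSucc]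
    simp only [Fin.snoc_castSucc, Fin.snoc_last]
    have h1 := hf 1
    have h2 : f 1 + 1 ≤ (∏ i, (β i + 1)) * (f 1 + 1) :=
      Nat.le_mul_of_pos_left _ (Finset.prod_pos fun i _ => Nat.succ_pos _)
    omega
  | succ j ih =>
    intro k D f β hf
    rw [boundAux]
    refine lt_of_lt_of_le ?_ (gSeq_monotone _ f (Nat.succ_le_succ (hB _)))
    rw [gSeq_succ_succ, zero_add, gSeq_one]
    have h := ih (k + 1) (3 * D) (fun i => f (1 + i)) (Fin.snoc β (f 1)) fun n => by
      refine le_trans (le_of_eq ?_) (hf (1 + n))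
      ring
    have e : 3 ^ (j + 1 + 1) * D = 3 ^ (j + 1) * (3 * D) := by ring
    omega

lemma one_le_bound : ∀ (m : ℕ) (f : ℕ → ℕ), 1 ≤ bound (m + 1) f
  | 0, f => by simp [bound]
  | m + 1, f => by
    have := lt_boundAux (one_le_bound m) (m + 1) 0 0 f Fin.elim0 (by simp)
    exact Nat.one_le_of_lt this

lemma lt_bound {m : ℕ} (hm : 1 ≤ m) (d : ℕ) : 3 ^ m * d < bound m fun n => 3 ^ n * d := by
  match m, hm with
  | 1, _ => simp [bound]
  | m + 2, _ =>
    rw [bound]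
    exact lt_boundAux (one_le_bound m) (m + 1) 0 d _ Fin.elim0 fun n => le_rfl

/-- The total degree reached in the elimination of `m` variables from polynomials of degree at
most `d`: eliminating one variable by resultants replaces `d` by `4d²`. -/
def elimDegree : ℕ → ℕ → ℕ
  | 0, d => d
  | m + 1, d => elimDegree m (4 * d ^ 2)

lemma four_mul_elimDegree (m : ℕ) : ∀ d, 4 * elimDegree m d = (4 * d) ^ 2 ^ m := by
  induction m with
  | zero => simp [elimDegree]
  | succ m ih =>
    intro d
    rw [elimDegree, ih, pow_succ' 2, pow_mul]
    congr 1
    ring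

lemma two_mul_two_pow_le (m : ℕ) : 2 * (2 ^ m - 1) ≤ 3 ^ m := by
  induction m with
  | zero => simp
  | succ m ih =>
    rcases m with _ | m
    · simp
    · have : 1 ≤ 2 ^ (m + 1) := Nat.one_le_two_pow
      have : 3 ≤ 3 ^ (m + 1) := Nat.le_self_pow (by omega) 3
      rw [pow_succ 2, pow_succ 3]
      omega

lemma four_mul_le_nine_pow (d : ℕ) : 4 * d ≤ 9 ^ d := by
  induction d with
  | zero => simp
  | succ d ih =>
    have : 1 ≤ 9 ^ d := Nat.one_le_pow _ _ (by norm_num)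
    rw [pow_succ]
    omega

lemma elimDegree_le (m d : ℕ) : elimDegree m d ≤ 3 ^ (3 ^ m * d) * d := by
  refine Nat.le_of_mul_le_mul_left (?_ : 4 * _ ≤ 4 * _) (by norm_num)
  have hpos : 1 ≤ 2 ^ m := Nat.one_le_two_pow
  calc 4 * elimDegree m d = (4 * d) ^ (2 ^ m - 1) * (4 * d) := by
        rw [four_mul_elimDegree, ← pow_succ, Nat.sub_add_cancel hpos]
    _ ≤ (9 ^ d) ^ (2 ^ m - 1) * (4 * d) := by
        gcongr
        exact four_mul_le_nine_pow d
    _ = 3 ^ (2 * (2 ^ m - 1) * d) * (4 * d) := by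
        rw [show 9 = 3 ^ 2 from rfl, ← pow_mul, ← pow_mul]
        ring_nf
    _ ≤ 3 ^ (3 ^ m * d) * (4 * d) := by
        gcongr
        · norm_num
        · exact two_mul_two_pow_le m
    _ = 4 * (3 ^ (3 ^ m * d) * d) := by ring

lemma elimDegree_le_gamma_add {m : ℕ} (hm : 1 ≤ m) (d : ℕ) :
    elimDegree m d ≤ gamma m d 0 + d := by
  have h := lt_bound hm d
  have h1 : 3 ^ (3 ^ m * d) ≤ 3 ^ (bound m (fun n => 3 ^ n * d) - 1) :=
    Nat.pow_le_pow_right (by norm_num) (by omega)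
  have h2 : 1 ≤ 3 ^ (bound m (fun n => 3 ^ n * d) - 1) := Nat.one_le_pow _ _ (by norm_num)
  calc elimDegree m d ≤ 3 ^ (3 ^ m * d) * d := elimDegree_le m d
    _ ≤ 3 ^ (bound m (fun n => 3 ^ n * d) - 1) * d := by gcongr
    _ = gamma m d 0 + d := by
      rw [gamma, add_zero, ← Nat.succ_mul, Nat.succ_eq_add_one, Nat.sub_add_cancel h2]

/-! ### Minors and rank -/

section Rank

variable {R C : Type} [Fintype R] [Fintype C] {K : Type*} [Field K]

lemma order_le_rank (A : Matrix R C K) (M : SquareSub R C) (hM : M.det A ≠ 0) :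
    M.order ≤ A.rank := by
  have h := Matrix.rank_of_isUnit (A.submatrix M.2.1 M.2.2)
    ((Matrix.isUnit_iff_isUnit_det _).2 (isUnit_iff_ne_zero.2 hM))
  rw [Fintype.card_fin] at h
  exact h.symm.le.trans (Matrix.rank_submatrix_le A M.2.1 M.2.2)

lemma exists_linearIndependent_rows {R C : Type*} [Finite R] [Fintype C] (A : Matrix R C K) {k : ℕ}
    (hk : A.rank = k) : ∃ r : Fin k ↪ R, LinearIndependent K fun i => A.row (r i) := by
  rw [Matrix.rank_eq_finrank_span_row] at hk
  subst hk
  obtain ⟨f, hf, -, hli⟩ := Submodule.exists_fun_fin_finrank_span_eq K (Set.range A.row)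
  choose r hr using hf
  have hrf : (fun i => A.row (r i)) = f := funext hr
  refine ⟨⟨r, fun i j hij => hli.injective ?_⟩, ?_⟩
  · rw [← hr i, ← hr j, hij]
  · change LinearIndependent K fun i => A.row (r i)
    rwa [hrf]

lemma exists_minor_ne_zero (A : Matrix R C K) (h : 0 < A.rank) :
    ∃ M : SquareSub R C, M.order = A.rank ∧ M.det A ≠ 0 := by
  obtain ⟨k, hk⟩ : ∃ k, A.rank = k + 1 := ⟨A.rank - 1, by omega⟩
  obtain ⟨r, hr⟩ := exists_linearIndependent_rows A hk
  have h1 : (A.submatrix r id).transpose.rank = k + 1 := by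
    rw [Matrix.rank_transpose]
    simpa using LinearIndependent.rank_matrix (M := A.submatrix r id) hr
  obtain ⟨c, hc⟩ := exists_linearIndependent_rows _ h1
  have hkR : k < Fintype.card R := by
    have := A.rank_le_card_height
    omega
  refine ⟨⟨⟨k, hkR⟩, r, c⟩, hk.symm, ?_⟩
  have h2 : LinearIndependent K (A.submatrix r c).transpose.row := hc
  rw [Matrix.linearIndependent_rows_iff_isUnit, Matrix.isUnit_iff_isUnit_det,
    Matrix.det_transpose] at h2
  exact h2.ne_zero

lemma rank_lt_rank_iff {C' : Type} [Fintype C'] (A : Matrix R C K) (B : Matrix R C' K)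
    (hB : 0 < B.rank) : A.rank < B.rank ↔
      ∀ M : SquareSub R C, M.det A ≠ 0 →
        ∃ N : SquareSub R C', M.order < N.order ∧ N.det B ≠ 0 := by
  obtain ⟨N, hN, hNB⟩ := exists_minor_ne_zero B hB
  constructor
  · exact fun h M hM => ⟨N, by have := order_le_rank A M hM; omega, hNB⟩
  · intro h
    rcases Nat.eq_zero_or_pos A.rank with h0 | h0
    · omega
    · obtain ⟨M, hM, hMA⟩ := exists_minor_ne_zero A h0
      obtain ⟨N', hN', hNB'⟩ := h M hMA
      have := order_le_rank B N' hNB'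
      omega

/-- The Rouché–Capelli criterion for the unsolvability of a linear system. -/
lemma rank_lt_rank_fromCols_iff {R C : Type*} [Finite R] [Fintype C] (A : Matrix R C K)
    (b : R → K) :
    A.rank < (Matrix.fromCols A (Matrix.of fun i (_ : Unit) => b i)).rank ↔
      ¬ ∃ c, A.mulVec c = b := by
  have hspan : (∃ c, A.mulVec c = b) ↔ b ∈ Submodule.span K (Set.range A.col) := by
    rw [← Matrix.range_mulVecLin]
    rfl
  have hcol : Set.range (Matrix.fromCols A (Matrix.of fun i (_ : Unit) => b i)).col =
      insert b (Set.range A.col) := by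
    ext v
    simp only [Set.mem_range, Sum.exists, Set.mem_insert_iff]
    rw [or_comm]
    refine or_congr ⟨fun ⟨_, h⟩ => h.symm, fun h => ⟨(), h.symm⟩⟩ Iff.rfl
  rw [hspan, Matrix.rank_eq_finrank_span_cols, Matrix.rank_eq_finrank_span_cols, hcol]
  constructor
  · intro h hb
    rw [Submodule.span_insert_eq_span hb] at h
    exact lt_irrefl _ h
  · intro hb
    refine Submodule.finrank_lt_finrank_of_lt
      (lt_of_le_of_ne (Submodule.span_mono (Set.subset_insert _ _)) fun h => hb ?_)
    rw [h]
    exact Submodule.subset_span (Set.mem_insert _ _)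

end Rank

/-! ### Realization of the formulas -/

section Realize

variable {n m s : ℕ} {K : Type*} [Field K]

lemma aeval_jointPoly (G : MvPolynomial (Fin m) (MvPolynomial (Fin n) ℤ)) (a : Fin n → K)
    (x : Fin m → K) : MvPolynomial.aeval (Sum.elim a x) (jointPoly G) =
      MvPolynomial.eval x (G.map (MvPolynomial.aeval a).toRingHom) := by
  rw [jointPoly, MvPolynomial.eval_map]
  change (MvPolynomial.aeval (Sum.elim a x)).toRingHom _ = _
  rw [MvPolynomial.hom_eval₂]
  congr 1
  · refine MvPolynomial.ringHom_ext' (RingHom.ext_int _ _) fun i => by simp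
  · ext j
    simp

lemma det_map {R C : Type} {S T : Type*} [Fintype R] [CommRing S] [CommRing T] (f : S →+* T)
    (M : SquareSub R C) (A : Matrix R C S) : f (M.det A) = M.det (A.map f) := by
  rw [SquareSub.det, SquareSub.det, RingHom.map_det, Matrix.submatrix_map]
  rfl

lemma augMatrix_map (d d' : ℕ) (F : Fin s → MvPolynomial (Fin m) (MvPolynomial (Fin n) ℤ))
    (a : Fin n → K) : (augMatrix d d' F).map (MvPolynomial.aeval a) =
      Matrix.fromCols ((coeffMatrix d d' F).map (MvPolynomial.aeval a))
        (Matrix.of fun δ (_ : Unit) => if δ.1 = 0 then 1 else 0) := by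
  ext δ (j | j)
  · rfl
  · simp [augMatrix, apply_ite (MvPolynomial.aeval a)]

lemma rank_augMatrix_pos (d d' : ℕ) (F : Fin s → MvPolynomial (Fin m) (MvPolynomial (Fin n) ℤ))
    (a : Fin n → K) : 0 < ((augMatrix d d' F).map (MvPolynomial.aeval a)).rank := by
  rw [Nat.pos_iff_ne_zero, Ne, Matrix.rank, Submodule.finrank_eq_zero, LinearMap.range_eq_bot,
    augMatrix_map]
  intro h
  have := congrFun (LinearMap.congr_fun h (Pi.single (Sum.inr ()) 1)) ⟨0, by simp⟩
  simp at this

variable [FirstOrder.Ring.CompatibleRing K]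

lemma realize_polyTerm {σ : Type} (p : MvPolynomial σ ℤ) (v : σ → K) :
    (polyTerm p).realize v = MvPolynomial.aeval v p := by
  rw [polyTerm, FirstOrder.Ring.realize_termOfFreeCommRing]
  have : (FreeCommRing.lift v).comp (freeCommRingEquivMvPolynomialInt σ).symm.toRingHom =
      (MvPolynomial.aeval v : MvPolynomial σ ℤ →ₐ[ℤ] K).toRingHom := by
    refine MvPolynomial.ringHom_ext' (RingHom.ext_int _ _) fun i => ?_
    have : (freeCommRingEquivMvPolynomialInt σ).symm (MvPolynomial.X i) = FreeCommRing.of i := by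
      rw [RingEquiv.symm_apply_eq]
      simp [freeCommRingEquivMvPolynomialInt]
    simp [this]
  exact DFunLike.congr_fun this p

lemma realize_neZero (p : MvPolynomial (Fin n) ℤ) (a : Fin n → K) :
    (neZero p).Realize a ↔ MvPolynomial.aeval a p ≠ 0 := by
  simp [neZero, realize_polyTerm]

lemma realize_commonRootFormula (F : Fin s → MvPolynomial (Fin m) (MvPolynomial (Fin n) ℤ))
    (a : Fin n → K) : (commonRootFormula F).Realize a ↔
      ∃ x : Fin m → K, ∀ i,
        MvPolynomial.eval x ((F i).map (MvPolynomial.aeval a).toRingHom) = 0 := by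
  rw [commonRootFormula, BoundedFormula.realize_exs]
  simp only [BoundedFormula.realize_iInf, BoundedFormula.realize_bdEqual, realize_polyTerm,
    FirstOrder.Ring.realize_zero, aeval_jointPoly]

lemma realize_delta (d d' : ℕ) (F : Fin s → MvPolynomial (Fin m) (MvPolynomial (Fin n) ℤ))
    (a : Fin n → K) : (delta d d' F).Realize a ↔
      ((coeffMatrix d d' F).map (MvPolynomial.aeval a)).rank <
        ((augMatrix d d' F).map (MvPolynomial.aeval a)).rank := by
  have h : (delta d d' F).Realize a ↔
      ∀ M : SquareSub (Exponents m (d + d')) (Fin s × Exponents m d'),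
        (neZero (M.det (coeffMatrix d d' F))).Realize a →
        ∃ N : {N : SquareSub (Exponents m (d + d')) ((Fin s × Exponents m d') ⊕ Unit) //
            M.order < N.order}, (neZero (N.1.det (augMatrix d d' F))).Realize a := by
    rw [delta, Formula.Realize, BoundedFormula.realize_iInf]
    refine forall_congr' fun M => ?_
    rw [BoundedFormula.realize_imp, BoundedFormula.realize_iSup]
    rfl
  rw [h, rank_lt_rank_iff _ _ (rank_augMatrix_pos d d' F a)]
  have h1 := fun M => det_map (MvPolynomial.aeval a).toRingHom M (coeffMatrix d d' F)
  have h2 := fun M => det_map (MvPolynomial.aeval a).toRingHom M (augMatrix d d' F)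
  simp only [realize_neZero, Subtype.exists, exists_prop]
  exact forall_congr' fun M => imp_congr (Iff.of_eq (congrArg (· ≠ 0) (h1 M)))
    (exists_congr fun N => and_congr_right fun _ => Iff.of_eq (congrArg (· ≠ 0) (h2 N)))

end Realize

/-! ### Quantifier-freeness -/

section QF
variable {L : Language} {α β : Type*} {k : ℕ} [Finite β]

lemma isQF_iSup {f : β → L.BoundedFormula α k} (hf : ∀ b, (f b).IsQF) :
    (BoundedFormula.iSup f).IsQF := by
  rw [BoundedFormula.iSup]
  generalize (@Finset.univ β (Fintype.ofFinite β)).toList = l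
  induction l with
  | nil => exact BoundedFormula.isQF_bot
  | cons b l ih => exact (hf b).sup ih

lemma isQF_iInf {f : β → L.BoundedFormula α k} (hf : ∀ b, (f b).IsQF) :
    (BoundedFormula.iInf f).IsQF := by
  rw [BoundedFormula.iInf]
  generalize (@Finset.univ β (Fintype.ofFinite β)).toList = l
  induction l with
  | nil => exact BoundedFormula.IsQF.top
  | cons b l ih => exact (hf b).inf ih

end QF

lemma isQF_neZero {n : ℕ} (p : MvPolynomial (Fin n) ℤ) : (neZero p).IsQF :=
  (BoundedFormula.IsAtomic.equal _ _).isQF.not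

lemma isQF_delta {n m s : ℕ} (d d' : ℕ)
    (F : Fin s → MvPolynomial (Fin m) (MvPolynomial (Fin n) ℤ)) : (delta d d' F).IsQF :=
  isQF_iInf fun _ => (isQF_neZero _).imp (isQF_iSup fun _ => isQF_neZero _)

/-! ### Models of the theory of algebraically closed fields -/

lemma isAlgClosed_of_model (K : Type*) [Field K] [FirstOrder.Ring.CompatibleRing K]
    [h : Theory.Model K ACF] : IsAlgClosed K := by
  refine IsAlgClosed.of_exists_root _ fun p hpm hpi => ?_
  have h : K ⊨ FirstOrder.Field.genericMonicPolyHasRoot '' {n | 0 < n} :=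
    Theory.Model.mono h (by simp [ACF])
  simp only [Theory.model_iff, Set.mem_image, forall_exists_index, and_imp] at h
  have := h _ p.natDegree (Polynomial.natDegree_pos_iff_degree_pos.2
    (Polynomial.degree_pos_of_irreducible hpi)) rfl
  rw [FirstOrder.Field.realize_genericMonicPolyHasRoot] at this
  exact this ⟨_, hpm, rfl⟩

/-! ### Degrees of resultants -/

section Degree

open MvPolynomial

variable {σ τ R : Type*} [CommRing R]

lemma totalDegree_aeval_le {L : σ → MvPolynomial τ R} (hL : ∀ i, (L i).totalDegree ≤ 1)
    (p : MvPolynomial σ R) : (aeval L p).totalDegree ≤ p.totalDegree := by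
  rw [aeval_def, eval₂_eq]
  refine totalDegree_finsetSum_le fun s hs => ?_
  refine (totalDegree_mul _ _).trans ?_
  rw [algebraMap_eq, totalDegree_C, zero_add]
  refine (totalDegree_finsetProd _ _).trans (le_trans ?_ (le_totalDegree hs))
  refine Finset.sum_le_sum fun i _ => (totalDegree_pow _ _).trans ?_
  simpa using Nat.mul_le_mul_left (s i) (hL i)

lemma totalDegree_det_le {ι : Type*} [Fintype ι] [DecidableEq ι]
    (A : Matrix ι ι (MvPolynomial σ R)) {d : ℕ} (hA : ∀ i j, (A i j).totalDegree ≤ d) :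
    A.det.totalDegree ≤ Fintype.card ι * d := by
  rw [Matrix.det_apply]
  refine totalDegree_finsetSum_le fun π _ => ?_
  have h : (∏ i, A (π i) i).totalDegree ≤ Fintype.card ι * d := by
    refine (totalDegree_finsetProd _ _).trans ?_
    refine (Finset.sum_le_sum fun i _ => hA (π i) i).trans ?_
    simp
  rcases Int.units_eq_one_or (Equiv.Perm.sign π) with h1 | h1
  · simpa [h1] using h
  · simpa [h1] using h

/-- The bound holds with the order of the matrix as a factor, since an entry of the adjugate is the
determinant of a matrix of the same order in which one row has been replaced by a unit vector. -/
lemma totalDegree_adjugate_le {ι : Type*} [Fintype ι] [DecidableEq ι]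
    (A : Matrix ι ι (MvPolynomial σ R)) {d : ℕ} (hA : ∀ i j, (A i j).totalDegree ≤ d) (i j : ι) :
    (A.adjugate i j).totalDegree ≤ Fintype.card ι * d := by
  rw [Matrix.adjugate_apply]
  refine totalDegree_det_le _ fun k l => ?_
  rw [Matrix.updateRow_apply]
  split_ifs
  · rw [Pi.single_apply]
    split_ifs <;> simp
  · exact hA k l

lemma totalDegree_sylvester_le {f g : Polynomial (MvPolynomial σ R)} {d : ℕ}
    (hf : ∀ i, (f.coeff i).totalDegree ≤ d) (hg : ∀ i, (g.coeff i).totalDegree ≤ d) (m n : ℕ)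
    (i j : Fin (m + n)) : (Polynomial.sylvester f g m n i j).totalDegree ≤ d := by
  rw [Polynomial.sylvester, Matrix.of_apply]
  refine Fin.addCases (fun k => ?_) (fun k => ?_) j
  · rw [Fin.addCases_left]
    split_ifs
    · exact hg _
    · simp
  · rw [Fin.addCases_right]
    split_ifs
    · exact hf _
    · simp

lemma totalDegree_resultant_le {f g : Polynomial (MvPolynomial σ R)} {d : ℕ}
    (hf : ∀ i, (f.coeff i).totalDegree ≤ d) (hg : ∀ i, (g.coeff i).totalDegree ≤ d) (m n : ℕ) :
    (Polynomial.resultant f g m n).totalDegree ≤ (m + n) * d := by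
  simpa [Polynomial.resultant] using totalDegree_det_le _ (totalDegree_sylvester_le hf hg m n)

/-- The Bézout identity of the resultant, with a bound on the degrees of the coefficients of the
cofactors, which are entries of the adjugate of the Sylvester matrix. -/
lemma exists_mul_add_mul_eq_C_resultant {f g : Polynomial (MvPolynomial σ R)} {d : ℕ}
    (hf : ∀ i, (f.coeff i).totalDegree ≤ d) (hg : ∀ i, (g.coeff i).totalDegree ≤ d) {m n : ℕ}
    (hfm : f.natDegree ≤ m) (hgn : g.natDegree ≤ n) (hn : 0 < n) :
    ∃ p q : Polynomial (MvPolynomial σ R), p.degree < n ∧ q.degree < m ∧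
      (∀ i, (p.coeff i).totalDegree ≤ (m + n) * d) ∧
      (∀ i, (q.coeff i).totalDegree ≤ (m + n) * d) ∧
      f * p + g * q = Polynomial.C (Polynomial.resultant f g m n) := by
  have hmn : 0 < m + n := by omega
  let b₁ := ((Polynomial.degreeLT.basis (MvPolynomial σ R) m).prod
    (Polynomial.degreeLT.basis (MvPolynomial σ R) n)).reindex finSumFinEquiv
  let b₂ := Polynomial.degreeLT.basis (MvPolynomial σ R) (m + n)
  let z : Fin (m + n) := ⟨0, hmn⟩
  let x := Polynomial.adjSylvester (m := m) (n := n) f g (b₂ z)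
  have hx : ((Polynomial.sylvesterMap f g hfm hgn x)).1 = _ :=
    congr(($(Polynomial.sylveserMap_comp_adjSylvester f g hfm hgn) (b₂ z)).1)
  have hb : ((b₂ z : Polynomial.degreeLT _ _) : Polynomial (MvPolynomial σ R)) = 1 := by
    simp [b₂, z]
  have hco : ∀ j, b₁.repr x j = (Polynomial.sylvester f g m n).adjugate j z := fun j => by
    have := congrFun (congrFun (LinearMap.toMatrix_toLin b₂ b₁
      (Polynomial.sylvester f g m n).adjugate) j) z
    rw [LinearMap.toMatrix_apply] at this
    exact this
  have hadj := totalDegree_adjugate_le _ (totalDegree_sylvester_le hf hg m n)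
  rw [Fintype.card_fin] at hadj
  refine ⟨x.2, x.1, Polynomial.mem_degreeLT.1 x.2.2, Polynomial.mem_degreeLT.1 x.1.2,
    fun i => ?_, fun i => ?_, ?_⟩
  · by_cases hi : i < n
    · have := hco (finSumFinEquiv (Sum.inr ⟨i, hi⟩))
      simp only [b₁, Module.Basis.repr_reindex_apply, Equiv.symm_apply_apply,
        Module.Basis.prod_repr_inr, Polynomial.degreeLT.basis_repr] at this
      rw [this]
      exact hadj _ _
    · rw [Polynomial.coeff_eq_zero_of_degree_lt ((Polynomial.mem_degreeLT.1 x.2.2).trans_le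
        (by exact_mod_cast not_lt.1 hi))]
      simp
  · by_cases hi : i < m
    · have := hco (finSumFinEquiv (Sum.inl ⟨i, hi⟩))
      simp only [b₁, Module.Basis.repr_reindex_apply, Equiv.symm_apply_apply,
        Module.Basis.prod_repr_inl, Polynomial.degreeLT.basis_repr] at this
      rw [this]
      exact hadj _ _
    · rw [Polynomial.coeff_eq_zero_of_degree_lt ((Polynomial.mem_degreeLT.1 x.1.2).trans_le
        (by exact_mod_cast not_lt.1 hi))]
      simp
  · simpa [hb, Algebra.smul_def] using hx

lemma finSuccEquiv_rename_succ {m : ℕ} (r : MvPolynomial (Fin m) R) :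
    finSuccEquiv R m (rename Fin.succ r) = Polynomial.C r := by
  have : (finSuccEquiv R m).toAlgHom.comp (rename Fin.succ) =
      Polynomial.CAlgHom (R := R) (A := MvPolynomial (Fin m) R) := by
    ext i : 1
    simp [finSuccEquiv_X_succ]
  exact DFunLike.congr_fun this r

lemma totalDegree_finSuccEquiv_symm_lt {m n a : ℕ} {p : Polynomial (MvPolynomial (Fin m) R)}
    (hp : p.degree < n) (hn : 0 < n) (ha : ∀ i, (p.coeff i).totalDegree ≤ a) :
    ((finSuccEquiv R m).symm p).totalDegree < a + n := by
  rcases n with _ | n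
  · omega
  rw [← add_assoc, Nat.lt_succ_iff]
  have hC : ∀ r : MvPolynomial (Fin m) R,
      (finSuccEquiv R m).symm (Polynomial.C r) = rename Fin.succ r := fun r => by
    rw [AlgEquiv.symm_apply_eq, finSuccEquiv_rename_succ r]
  have hX : (finSuccEquiv R m).symm Polynomial.X = X 0 := by
    rw [AlgEquiv.symm_apply_eq, finSuccEquiv_X_zero]
  have hnat : p.natDegree < n + 1 := by
    by_cases h0 : p = 0
    · simp [h0]
    · exact (Polynomial.natDegree_lt_iff_degree_lt h0).2 hp
  rw [Polynomial.as_sum_range' p (n + 1) hnat, map_sum]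
  refine totalDegree_finsetSum_le fun i hi => ?_
  rw [← Polynomial.C_mul_X_pow_eq_monomial, map_mul, map_pow, hC, hX]
  refine (totalDegree_mul _ _).trans (add_le_add ((totalDegree_rename_le _ _).trans (ha i)) ?_)
  have : (X 0 ^ i : MvPolynomial (Fin (m + 1)) R).totalDegree ≤ i := by
    rcases subsingleton_or_nontrivial R with _ | _
    · rw [Subsingleton.elim (X 0 ^ i : MvPolynomial (Fin (m + 1)) R) 0]
      simp
    · simp
  have := Finset.mem_range.1 hi
  omega

lemma totalDegree_coeff_finSuccEquiv_le {m : ℕ} (p : MvPolynomial (Fin (m + 1)) R) (i : ℕ) :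
    ((finSuccEquiv R m p).coeff i).totalDegree ≤ p.totalDegree := by
  by_cases h : (finSuccEquiv R m p).coeff i = 0
  · simp [h]
  · have := totalDegree_coeff_finSuccEquiv_add_le p i h
    omega

lemma natDegree_finSuccEquiv_le {m : ℕ} (p : MvPolynomial (Fin (m + 1)) R) :
    (finSuccEquiv R m p).natDegree ≤ p.totalDegree := by
  rw [natDegree_finSuccEquiv]
  exact degreeOf_le_totalDegree p 0

end Degree

/-! ### Linear changes of coordinates -/

section Coordinates

open MvPolynomial

variable {m : ℕ} {K : Type*} [Field K]

/-- The linear change of coordinates that makes the `0`-th coordinate axis point in the direction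
of `v`. -/
noncomputable def directionChange (v : Fin (m + 1) → K) (hv : v 0 ≠ 0) :
    MvPolynomial (Fin (m + 1)) K ≃ₐ[K] MvPolynomial (Fin (m + 1)) K :=
  AlgEquiv.ofAlgHom
    (aeval (Fin.cases (C (v 0) * X 0) fun i => X i.succ + C (v i.succ) * X 0))
    (aeval (Fin.cases (C (v 0)⁻¹ * X 0) fun i => X i.succ - C (v i.succ * (v 0)⁻¹) * X 0))
    (by
      ext i : 1
      refine Fin.cases ?_ (fun i => ?_) i
      · simp only [AlgHom.comp_apply, aeval_X, Fin.cases_zero, map_mul, algHom_C, algebraMap_eq,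
          AlgHom.id_apply]
        rw [← mul_assoc, ← C_mul, inv_mul_cancel₀ hv, C_1, one_mul]
      · simp [algebraMap_eq]
        rw [mul_assoc, ← mul_assoc (C _) (C _) (X 0), ← C_mul, inv_mul_cancel₀ hv, C_1, one_mul,
          add_sub_cancel_right])
    (by
      ext i : 1
      refine Fin.cases ?_ (fun i => ?_) i
      · simp only [AlgHom.comp_apply, aeval_X, Fin.cases_zero, map_mul, algHom_C, algebraMap_eq,
          AlgHom.id_apply]
        rw [← mul_assoc, ← C_mul, mul_inv_cancel₀ hv, C_1, one_mul]
      · simp [algebraMap_eq]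
        rw [mul_assoc, sub_add_cancel])

lemma totalDegree_C_mul_X_le (c : K) (i : Fin m) : (C c * X i).totalDegree ≤ 1 :=
  (totalDegree_mul _ _).trans (by simp)

lemma totalDegree_directionChange_le (v : Fin (m + 1) → K) (hv : v 0 ≠ 0)
    (p : MvPolynomial (Fin (m + 1)) K) :
    (directionChange v hv p).totalDegree ≤ p.totalDegree :=
  totalDegree_aeval_le (fun i => Fin.cases (totalDegree_C_mul_X_le _ _)
    (fun i => (totalDegree_add _ _).trans (max_le (by simp) (totalDegree_C_mul_X_le _ _))) i) p

lemma totalDegree_directionChange_symm_le (v : Fin (m + 1) → K) (hv : v 0 ≠ 0)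
    (p : MvPolynomial (Fin (m + 1)) K) :
    ((directionChange v hv).symm p).totalDegree ≤ p.totalDegree :=
  totalDegree_aeval_le (fun i => Fin.cases (totalDegree_C_mul_X_le _ _)
    (fun i => (totalDegree_sub _ _).trans (max_le (by simp) (totalDegree_C_mul_X_le _ _))) i) p

lemma eval_homogeneousComponent_monomial {σ : Type*} (v : σ → K) (s : σ →₀ ℕ) (c : K) (e : ℕ) :
    eval v (homogeneousComponent e (monomial s c)) =
      if s.degree = e then c * s.prod fun i k => v i ^ k else 0 := by
  rw [homogeneousComponent_of_mem (isHomogeneous_monomial c rfl)]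
  by_cases h : s.degree = e
  · rw [if_pos h.symm, if_pos h, eval_monomial]
  · rw [if_neg (Ne.symm h), if_neg h, map_zero]

lemma coeff_aeval_C_mul_X {σ : Type*} (v : σ → K) (p : MvPolynomial σ K) (e : ℕ) :
    (aeval (fun i => Polynomial.C (v i) * Polynomial.X) p : Polynomial K).coeff e =
      eval v (homogeneousComponent e p) := by
  induction p using MvPolynomial.induction_on' with
  | add p q hp hq => simp [hp, hq]
  | monomial s c =>
    rw [aeval_monomial, eval_homogeneousComponent_monomial]
    simp only [mul_pow, Finsupp.prod_mul, ← map_pow]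
    rw [show (s.prod fun i k => Polynomial.C (v i ^ k)) =
        Polynomial.C (s.prod fun i k => v i ^ k) from (map_finsuppProd _ _ _).symm,
      show (s.prod fun _ k => (Polynomial.X : Polynomial K) ^ k) = Polynomial.X ^ s.degree from
        Finset.prod_pow_eq_pow_sum _ _ _, ← mul_assoc, Polynomial.algebraMap_eq,
      ← Polynomial.C_mul, Polynomial.coeff_C_mul_X_pow]
    simp only [eq_comm]

/-- Restricted to the `0`-th coordinate axis, the transformed polynomial is the restriction of `p`
to the line spanned by `v`. -/
lemma map_finSuccEquiv_directionChange (v : Fin (m + 1) → K) (hv : v 0 ≠ 0)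
    (p : MvPolynomial (Fin (m + 1)) K) :
    (finSuccEquiv K m (directionChange v hv p)).map (eval 0) =
      aeval (fun i => Polynomial.C (v i) * Polynomial.X) p := by
  have hC : ∀ c, finSuccEquiv K m (C c) = Polynomial.C (C c) := (finSuccEquiv K m).commutes
  have : ((Polynomial.mapAlgHom (aeval (0 : Fin m → K))).comp
      (finSuccEquiv K m).toAlgHom).comp (directionChange v hv).toAlgHom =
      aeval (fun i => Polynomial.C (v i) * Polynomial.X) := by
    ext i : 1
    refine Fin.cases ?_ (fun i => ?_) i
    · simp [directionChange, hC, finSuccEquiv_X_zero]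
    · simp [directionChange, hC, finSuccEquiv_X_zero, finSuccEquiv_X_succ]
  exact DFunLike.congr_fun this p

/-- Up to a nonzero constant, a nonzero polynomial becomes monic in the `0`-th variable if the axis
is turned into a direction in which its leading form does not vanish. -/
lemma exists_coordinate_change [Infinite K] {F : MvPolynomial (Fin (m + 1)) K} (hF : F ≠ 0) :
    ∃ φ : MvPolynomial (Fin (m + 1)) K ≃ₐ[K] MvPolynomial (Fin (m + 1)) K,
      (∀ p, (φ p).totalDegree ≤ p.totalDegree) ∧ (∀ p, (φ.symm p).totalDegree ≤ p.totalDegree) ∧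
      ∃ c : K, c ≠ 0 ∧ (finSuccEquiv K m (φ F)).coeff F.totalDegree = C c := by
  have htop : homogeneousComponent F.totalDegree F ≠ 0 := by
    obtain ⟨s, hs, hsF⟩ := Finset.exists_mem_eq_sup F.support
      (Finset.nonempty_iff_ne_empty.2 (by simpa using hF)) fun s => s.sum fun _ e => e
    intro h
    have hdeg : s.degree = F.totalDegree := hsF.symm
    have := congrArg (coeff s) h
    rw [coeff_homogeneousComponent, if_pos hdeg, coeff_zero] at this
    exact mem_support_iff.1 hs this
  -- The factor `X 0` ensures `v 0 ≠ 0`, so that the change of coordinates is invertible.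
  obtain ⟨v, hv⟩ : ∃ v, eval v (homogeneousComponent F.totalDegree F * X 0) ≠ 0 := by
    by_contra! h
    exact mul_ne_zero htop (X_ne_zero _) (MvPolynomial.funext fun v => by simpa using h v)
  rw [map_mul, eval_X] at hv
  have hv0 := right_ne_zero_of_mul hv
  refine ⟨directionChange v hv0, totalDegree_directionChange_le v hv0,
    totalDegree_directionChange_symm_le v hv0, _, left_ne_zero_of_mul hv, ?_⟩
  -- The coefficient is constant for reasons of degree, so it can be computed on the axis.
  have h := congrArg (Polynomial.coeff · F.totalDegree) (map_finSuccEquiv_directionChange v hv0 F)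
  simp only [Polynomial.coeff_map, coeff_aeval_C_mul_X] at h
  have h0 : ((finSuccEquiv K m (directionChange v hv0 F)).coeff F.totalDegree).totalDegree = 0 := by
    by_cases hz : (finSuccEquiv K m (directionChange v hv0 F)).coeff F.totalDegree = 0
    · simp [hz]
    · have h1 := totalDegree_coeff_finSuccEquiv_add_le _ _ hz
      have h2 := totalDegree_directionChange_le v hv0 F
      omega
  rw [totalDegree_eq_zero_iff_eq_C] at h0
  rw [← h, h0]
  simp

end Coordinates

/-! ### An effective Nullstellensatz -/

section Nullstellensatz

open MvPolynomial

variable {σ τ K : Type*} [Field K]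

/-- The linear combinations `∑ hᵢ pᵢ` of polynomials `pᵢ ∈ S` with `deg hᵢ + d ≤ N`.  If the
polynomials in `S` have degree at most `d`, then all products `hᵢ pᵢ` have degree at most `N`. -/
noncomputable def boundedCombinations (S : Set (MvPolynomial σ K)) (d N : ℕ) :
    Submodule K (MvPolynomial σ K) :=
  Submodule.span K {q | ∃ h, ∃ p ∈ S, h.totalDegree + d ≤ N ∧ h * p = q}

lemma mul_mem_boundedCombinations {S : Set (MvPolynomial σ K)} {d N : ℕ} {h p : MvPolynomial σ K}
    (hh : h.totalDegree + d ≤ N) (hp : p ∈ Submodule.span K S) :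
    h * p ∈ boundedCombinations S d N := by
  induction hp using Submodule.span_induction with
  | mem p hp => exact Submodule.subset_span ⟨h, p, hp, hh, rfl⟩
  | zero => simp
  | add p q _ _ hp hq => rw [mul_add]; exact add_mem hp hq
  | smul c p _ hp => rw [mul_smul_comm]; exact Submodule.smul_mem _ c hp

lemma one_mem_boundedCombinations_of_C_mem {S : Set (MvPolynomial σ K)} {d N : ℕ} {a : K}
    (ha : a ≠ 0) (hS : C a ∈ S) (hN : d ≤ N) : 1 ∈ boundedCombinations S d N :=
  Submodule.subset_span ⟨C a⁻¹, C a, hS, by simpa using hN, by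
    rw [← C_mul, inv_mul_cancel₀ ha, C_1]⟩

/-- Membership in a set of bounded combinations is transported by an algebra homomorphism `φ` that
does not raise degrees.  The degree bound `d'` of the target set may differ from `d`. -/
lemma map_boundedCombinations_le {S : Set (MvPolynomial σ K)} {T : Set (MvPolynomial τ K)}
    (φ : MvPolynomial σ K →ₐ[K] MvPolynomial τ K) (hφ : ∀ p, (φ p).totalDegree ≤ p.totalDegree)
    {d N d' : ℕ} (hS : ∀ p ∈ S, ∀ h : MvPolynomial τ K, h.totalDegree + d ≤ N →
      h * φ p ∈ boundedCombinations T d' N) {q : MvPolynomial σ K}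
    (hq : q ∈ boundedCombinations S d N) : φ q ∈ boundedCombinations T d' N := by
  have : boundedCombinations S d N ≤ (boundedCombinations T d' N).comap φ.toLinearMap := by
    refine Submodule.span_le.2 ?_
    rintro _ ⟨h, p, hp, hh, rfl⟩
    change φ (h * p) ∈ boundedCombinations T d' N
    rw [map_mul]
    exact hS p hp _ ((Nat.add_le_add_right (hφ h) d).trans hh)
  exact this hq

lemma eval_algHom (φ : MvPolynomial σ K →ₐ[K] MvPolynomial τ K) (x : τ → K)
    (p : MvPolynomial σ K) : eval x (φ p) = eval (fun i => eval x (φ (X i))) p := by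
  have : (aeval x).comp φ = aeval fun i => eval x (φ (X i)) := by
    ext i : 1
    simp
  exact DFunLike.congr_fun this p

lemma totalDegree_le_of_mem_span {S : Set (MvPolynomial σ K)} {d : ℕ}
    (hS : ∀ p ∈ S, p.totalDegree ≤ d) {p : MvPolynomial σ K} (hp : p ∈ Submodule.span K S) :
    p.totalDegree ≤ d := by
  have h : Submodule.span K S ≤ restrictTotalDegree σ K d :=
    Submodule.span_le.2 fun q hq => (mem_restrictTotalDegree _ _ _).2 (hS q hq)
  exact (mem_restrictTotalDegree _ _ _).1 (h hp)

/-- The resultant with respect to the first variable of two polynomials of degree at most `d` is a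
bounded combination of them. -/
lemma mul_resultant_mem_boundedCombinations {m : ℕ} {S : Set (MvPolynomial (Fin (m + 1)) K)}
    {d N e : ℕ} (hd : 1 ≤ d) (he : e ≤ d) {F G : MvPolynomial (Fin (m + 1)) K}
    (hF : F.totalDegree ≤ e) (hG : G.totalDegree ≤ d) (hFS : F ∈ Submodule.span K S)
    (hGS : G ∈ Submodule.span K S) {h : MvPolynomial (Fin (m + 1)) K}
    (hh : h.totalDegree + 4 * d ^ 2 ≤ N) :
    h * rename Fin.succ (Polynomial.resultant (finSuccEquiv K m F) (finSuccEquiv K m G) e d) ∈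
      boundedCombinations S d N := by
  obtain ⟨p, q, hp, hq, hpc, hqc, hpq⟩ := exists_mul_add_mul_eq_C_resultant (d := d)
    (fun i => (totalDegree_coeff_finSuccEquiv_le F i).trans (hF.trans he))
    (fun i => (totalDegree_coeff_finSuccEquiv_le G i).trans hG)
    ((natDegree_finSuccEquiv_le F).trans hF) ((natDegree_finSuccEquiv_le G).trans hG) hd
  have hp' := totalDegree_finSuccEquiv_symm_lt hp hd hpc
  have hq' := totalDegree_finSuccEquiv_symm_lt (hq.trans_le (by exact_mod_cast he)) hd hqc
  have hdeg : (e + d) * d + d + d ≤ 4 * d ^ 2 := by nlinarith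
  have hid : F * (finSuccEquiv K m).symm p + G * (finSuccEquiv K m).symm q =
      rename Fin.succ (Polynomial.resultant (finSuccEquiv K m F) (finSuccEquiv K m G) e d) := by
    apply (finSuccEquiv K m).injective
    rw [finSuccEquiv_rename_succ, ← hpq]
    simp
  rw [← hid, mul_add, mul_comm F, mul_comm G, ← mul_assoc, ← mul_assoc]
  have h1 := totalDegree_mul h ((finSuccEquiv K m).symm p)
  have h2 := totalDegree_mul h ((finSuccEquiv K m).symm q)
  exact add_mem (mul_mem_boundedCombinations (by omega) hFS)
    (mul_mem_boundedCombinations (by omega) hGS)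

/-- If `F` is, up to a constant, monic in the first variable and the polynomials in `S` have no
common zero, then the resultants of `F` with the elements of the span of `S` have no common zero:
over each point there are finitely many zeros of `F`, and some element of the span vanishes at none
of them. -/
lemma exists_eval_resultant_ne_zero [IsAlgClosed K] {m d e : ℕ}
    {S : Set (MvPolynomial (Fin (m + 1)) K)} (hS : ∀ p ∈ S, p.totalDegree ≤ d)
    (hS0 : ∀ x, ∃ p ∈ S, eval x p ≠ 0) {F : MvPolynomial (Fin (m + 1)) K}
    (hF : F.totalDegree ≤ e) {c : K} (hc : c ≠ 0) (hFc : (finSuccEquiv K m F).coeff e = C c)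
    (y : Fin m → K) : ∃ G ∈ Submodule.span K S,
      eval y (Polynomial.resultant (finSuccEquiv K m F) (finSuccEquiv K m G) e d) ≠ 0 := by
  have : Infinite K := IsAlgClosed.instInfinite
  set f := (finSuccEquiv K m F).map (eval y) with hf
  have hfc : f.coeff e = c := by simp [hf, hFc]
  have hfe : f.natDegree = e := Polynomial.natDegree_eq_of_le_of_coeff_ne_zero
    (Polynomial.natDegree_map_le.trans ((natDegree_finSuccEquiv_le F).trans hF))
    (by rwa [hfc])
  have : Finite {z // z ∈ f.roots} := (Multiset.finite_toSet f.roots).to_subtype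
  obtain ⟨G, hG, hG0⟩ := Module.Dual.exists_forall_mem_ne_zero_of_forall_exists
    (Submodule.span K S)
    (fun z : {z // z ∈ f.roots} => (aeval (Fin.cons z.1 y : Fin (m + 1) → K)).toLinearMap)
    (fun z => by
      obtain ⟨p, hp, hp0⟩ := hS0 (Fin.cons z.1 y)
      exact ⟨p, Submodule.subset_span hp, hp0⟩)
  refine ⟨G, hG, ?_⟩
  have hgd : ((finSuccEquiv K m G).map (eval y)).natDegree ≤ d :=
    Polynomial.natDegree_map_le.trans ((natDegree_finSuccEquiv_le G).trans
      (totalDegree_le_of_mem_span hS hG))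
  have hlc : f.leadingCoeff ≠ 0 := by rwa [Polynomial.leadingCoeff, hfe, hfc]
  rw [← Polynomial.resultant_map_map, ← hf, ← hfe,
    Polynomial.resultant_eq_prod_eval _ _ _ hgd (IsAlgClosed.splits f)]
  refine mul_ne_zero (pow_ne_zero _ hlc) (Multiset.prod_ne_zero fun h0 => ?_)
  obtain ⟨z, hz, hz0⟩ := Multiset.mem_map.1 h0
  refine hG0 ⟨z, hz⟩ ?_
  change eval (Fin.cons z y) G = 0
  rwa [eval_eq_eval_mv_eval']

/-- An effective Nullstellensatz: over an algebraically closed field, `1` is a combination, with a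
degree bound, of any set of polynomials of degree at most `d` without common zero. -/
theorem one_mem_boundedCombinations [IsAlgClosed K] (m : ℕ) :
    ∀ {d : ℕ}, 1 ≤ d → ∀ {S : Set (MvPolynomial (Fin m) K)}, (∀ p ∈ S, p.totalDegree ≤ d) →
      (∀ x, ∃ p ∈ S, eval x p ≠ 0) → 1 ∈ boundedCombinations S d (elimDegree m d) := by
  have : Infinite K := IsAlgClosed.instInfinite
  induction m with
  | zero =>
    intro d hd S hS hS0
    obtain ⟨p, hp, hp0⟩ := hS0 0
    obtain ⟨a, rfl⟩ : ∃ a, p = C a := ⟨_, p.eq_C_of_isEmpty⟩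
    rw [eval_C] at hp0
    exact one_mem_boundedCombinations_of_C_mem hp0 hp le_rfl
  | succ m ih =>
    intro d hd S hS hS0
    obtain ⟨F, hFS, hF0⟩ := hS0 0
    have hF : F ≠ 0 := by
      rintro rfl
      simp at hF0
    obtain ⟨φ, hφ, hφs, c, hc, hFc⟩ := exists_coordinate_change hF
    have hS' : ∀ p ∈ φ '' S, p.totalDegree ≤ d := by
      rintro _ ⟨p, hp, rfl⟩
      exact (hφ p).trans (hS p hp)
    have hS0' : ∀ x, ∃ p ∈ φ '' S, eval x p ≠ 0 := fun x => by
      obtain ⟨p, hp, hp0⟩ := hS0 fun i => eval x (φ (X i))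
      exact ⟨φ p, ⟨p, hp, rfl⟩, fun h => hp0 ((eval_algHom φ.toAlgHom x p).symm.trans h)⟩
    have hFS' : φ F ∈ Submodule.span K (φ '' S) := Submodule.subset_span ⟨F, hFS, rfl⟩
    -- The family of resultants of the transformed `F` with the span of the transformed `S`.
    let T : Set (MvPolynomial (Fin m) K) := {r | ∃ G ∈ Submodule.span K (φ '' S),
      Polynomial.resultant (finSuccEquiv K m (φ F)) (finSuccEquiv K m G) F.totalDegree d = r}
    have hT : ∀ r ∈ T, r.totalDegree ≤ 4 * d ^ 2 := by
      rintro _ ⟨G, hG, rfl⟩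
      have hFd := hS F hFS
      refine (totalDegree_resultant_le (d := d) (fun i => ?_) (fun i => ?_) _ _).trans ?_
      · exact (totalDegree_coeff_finSuccEquiv_le _ i).trans (hS' _ ⟨F, hFS, rfl⟩)
      · exact (totalDegree_coeff_finSuccEquiv_le _ i).trans (totalDegree_le_of_mem_span hS' hG)
      · nlinarith
    have h1 := ih (by nlinarith : 1 ≤ 4 * d ^ 2) hT fun y => by
      obtain ⟨G, hG, hG0⟩ := exists_eval_resultant_ne_zero hS' hS0' (hφ F) hc hFc y
      exact ⟨_, ⟨G, hG, rfl⟩, hG0⟩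
    have h2 : rename Fin.succ 1 ∈ boundedCombinations (φ '' S) d (elimDegree (m + 1) d) := by
      refine map_boundedCombinations_le _ (totalDegree_rename_le _) ?_ h1
      rintro _ ⟨G, hG, rfl⟩ h hh
      exact mul_resultant_mem_boundedCombinations hd (hS F hFS) (hφ F)
        (totalDegree_le_of_mem_span hS' hG) hFS' hG hh
    rw [map_one] at h2
    have h3 := map_boundedCombinations_le φ.symm.toAlgHom hφs (T := S) (d' := d) (by
      rintro _ ⟨p, hp, rfl⟩ h hh
      refine mul_mem_boundedCombinations hh (Submodule.subset_span ?_)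
      simpa using hp) h2
    rwa [map_one] at h3

end Nullstellensatz

/-! ### The linear system and common roots -/

section System

open MvPolynomial

variable {n m s d d' : ℕ} {K : Type*} [Field K]

lemma coeffMatrix_map_apply (F : Fin s → MvPolynomial (Fin m) (MvPolynomial (Fin n) ℤ))
    (a : Fin n → K) (δ : Exponents m (d + d')) (j : Fin s × Exponents m d') :
    (coeffMatrix d d' F).map (aeval a) δ j =
      coeff δ.1 (monomial j.2.1 1 * (F j.1).map (aeval a).toRingHom) := by
  rw [coeff_monomial_mul', Matrix.map_apply, coeffMatrix, Matrix.of_apply, apply_ite (aeval a),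
    map_zero, coeff_map, one_mul]
  rfl

lemma totalDegree_map_le {R S σ : Type*} [CommSemiring R] [CommSemiring S] (f : R →+* S)
    (p : MvPolynomial σ R) : (p.map f).totalDegree ≤ p.totalDegree :=
  Finset.sup_mono (support_map_subset f p)

/-- The linear system with the matrix `A` and the right hand side `1, 0, …, 0` is solvable if and
only if `1` is a linear combination of the products of the `Fᵢ` with monomials of degree at most
`d'`. -/
lemma exists_coeffMatrix_mulVec_eq_iff
    (F : Fin s → MvPolynomial (Fin m) (MvPolynomial (Fin n) ℤ))
    (hF : ∀ i, (F i).totalDegree ≤ d) (a : Fin n → K) :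
    (∃ c, ((coeffMatrix d d' F).map (aeval a)).mulVec c =
        fun δ : Exponents m (d + d') => if δ.1 = 0 then 1 else 0) ↔
      (1 : MvPolynomial (Fin m) K) ∈ Submodule.span K
        (Set.range fun j : Fin s × Exponents m d' =>
          monomial j.2.1 1 * (F j.1).map (aeval a).toRingHom) := by
  rw [Submodule.mem_span_range_iff_exists_fun]
  refine exists_congr fun c => ?_
  set P := ∑ j : Fin s × Exponents m d',
    c j • ((monomial j.2.1 1 : MvPolynomial (Fin m) K) * (F j.1).map (aeval a).toRingHom) with hP
  have hcoeff : ∀ δ : Exponents m (d + d'),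
      ((coeffMatrix d d' F).map (aeval a)).mulVec c δ = coeff δ.1 P := fun δ => by
    rw [hP, coeff_sum, Matrix.mulVec, dotProduct]
    refine Finset.sum_congr rfl fun j _ => ?_
    rw [coeffMatrix_map_apply, coeff_smul, smul_eq_mul, mul_comm]
  have hdeg : P.totalDegree ≤ d + d' := by
    refine totalDegree_finsetSum_le fun j _ => (totalDegree_smul_le _ _).trans ?_
    have h1 := (totalDegree_map_le (aeval a).toRingHom (F j.1)).trans (hF j.1)
    have h2 : (monomial j.2.1 1 : MvPolynomial (Fin m) K).totalDegree ≤ d' :=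
      (totalDegree_monomial_le _ _).trans j.2.2
    exact (totalDegree_mul _ _).trans (by omega)
  constructor
  · intro h
    ext δ
    rw [coeff_one]
    by_cases hδ : δ.degree ≤ d + d'
    · have := congrFun h ⟨δ, hδ⟩
      rw [hcoeff] at this
      simpa only [eq_comm] using this
    · have h0 : (0 : Fin m →₀ ℕ) ≠ δ := by
        rintro rfl
        simp at hδ
      rw [if_neg h0]
      exact coeff_eq_zero_of_totalDegree_lt (hdeg.trans_lt (not_le.1 hδ))
  · intro h
    ext δ
    rw [hcoeff, h, coeff_one]
    simp only [eq_comm]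

lemma boundedCombinations_le_span (F : Fin s → MvPolynomial (Fin m) K) {N : ℕ}
    (hN : N ≤ d' + d) : boundedCombinations (Set.range F) d N ≤ Submodule.span K
      (Set.range fun j : Fin s × Exponents m d' => monomial j.2.1 1 * F j.1) := by
  refine Submodule.span_le.2 ?_
  rintro _ ⟨h, _, ⟨i, rfl⟩, hh, rfl⟩
  rw [h.as_sum, Finset.sum_mul]
  refine sum_mem fun β hβ => ?_
  have hβ' : β.degree ≤ d' := by
    have : β.degree ≤ h.totalDegree := le_totalDegree hβ
    omega
  rw [show monomial β (coeff β h) = coeff β h • monomial β 1 by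
    rw [smul_monomial, smul_eq_mul, mul_one], smul_mul_assoc]
  exact Submodule.smul_mem _ _ (Submodule.subset_span ⟨(i, ⟨β, hβ'⟩), rfl⟩)

/-- Hilbert's Nullstellensatz with the degree bound `γ_{m,d}(0)`. -/
lemma one_mem_span_iff_not_exists_root [IsAlgClosed K] (hm : 1 ≤ m)
    (F : Fin s → MvPolynomial (Fin m) K) (hF : ∀ i, (F i).totalDegree ≤ d) :
    1 ∈ Submodule.span K (Set.range fun j : Fin s × Exponents m (gamma m d 0) =>
        monomial j.2.1 1 * F j.1) ↔
      ¬ ∃ x : Fin m → K, ∀ i, eval x (F i) = 0 := by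
  constructor
  · rintro h ⟨x, hx⟩
    have hle : Submodule.span K (Set.range fun j : Fin s × Exponents m (gamma m d 0) =>
        monomial j.2.1 1 * F j.1) ≤ LinearMap.ker (aeval x).toLinearMap := by
      refine Submodule.span_le.2 ?_
      rintro _ ⟨j, rfl⟩
      change eval x _ = 0
      rw [map_mul, hx, mul_zero]
    have h1 : eval x (1 : MvPolynomial (Fin m) K) = 0 := hle h
    simp at h1
  · intro h
    push Not at h
    have hS : ∀ p ∈ Set.range F, p.totalDegree ≤ d := by
      rintro _ ⟨i, rfl⟩
      exact hF i
    have hS0 : ∀ x, ∃ p ∈ Set.range F, eval x p ≠ 0 := fun x => by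
      obtain ⟨i, hi⟩ := h x
      exact ⟨F i, ⟨i, rfl⟩, hi⟩
    rcases Nat.eq_zero_or_pos d with rfl | hd
    · -- Polynomials of degree `0` are constants, and one of them is not zero.
      obtain ⟨p, hp, hp0⟩ := hS0 0
      have hpC := totalDegree_eq_zero_iff_eq_C.1 (Nat.le_zero.1 (hS p hp))
      rw [hpC, eval_C] at hp0
      rw [hpC] at hp
      exact boundedCombinations_le_span F (Nat.zero_le _)
        (one_mem_boundedCombinations_of_C_mem hp0 hp le_rfl)
    · exact boundedCombinations_le_span F (elimDegree_le_gamma_add hm d)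
        (one_mem_boundedCombinations m hd hS hS0)

end System

end TarskiQE

theorem theorem3p2 (n m s : ℕ) (hm : 1 ≤ m)
    (F : Fin s → MvPolynomial (Fin m) (MvPolynomial (Fin n) ℤ))
    (d d' : ℕ) (hd : d = Finset.univ.sup fun i => (F i).totalDegree)
    (hd' : d' = TarskiQE.gamma m d 0) :
    (TarskiQE.ACF ⊨ᵇ (TarskiQE.commonRootFormula F).iff (TarskiQE.delta d d' F)) ∧
    (TarskiQE.delta d d' F).IsQF ∧
    ∀ (K : Type*) [Field K] [FirstOrder.Ring.CompatibleRing K] (a : Fin n → K),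
      (TarskiQE.delta d d' F).Realize a ↔
        ((TarskiQE.coeffMatrix d d' F).map (MvPolynomial.aeval a)).rank <
          ((TarskiQE.augMatrix d d' F).map (MvPolynomial.aeval a)).rank := by
  refine ⟨?_, TarskiQE.isQF_delta d d' F, fun K _ _ a => TarskiQE.realize_delta d d' F a⟩
  rw [Theory.models_formula_iff]
  intro M a
  have : Theory.field.Model M :=
    Theory.Model.mono M.is_model Set.subset_union_left
  let _ := FirstOrder.Field.fieldOfModelField M
  let _ := FirstOrder.Field.compatibleRingOfModelField M
  have := M.is_model
  have : IsAlgClosed M := TarskiQE.isAlgClosed_of_model M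
  have hF : ∀ i, (F i).totalDegree ≤ d := fun i => by
    rw [hd]
    exact Finset.le_sup (f := fun i => (F i).totalDegree) (Finset.mem_univ i)
  rw [Formula.realize_iff, TarskiQE.realize_commonRootFormula, TarskiQE.realize_delta,
    TarskiQE.augMatrix_map,
    TarskiQE.rank_lt_rank_fromCols_iff, TarskiQE.exists_coeffMatrix_mulVec_eq_iff F hF a, hd',
    TarskiQE.one_mem_span_iff_not_exists_root hm _ fun i =>
      (TarskiQE.totalDegree_map_le _ _).trans (hF i), not_not]
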